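/- Let $L\ge 1$ be an integer and let $\Omega$ be the set of all $\omega=(\mu_i^L,\dots,\mu_i^1,\lambda_i)_{i\in\mathbb Z}$ with $\lambda_i,\mu_i^l\ge 0$, equipped with its Borel $\sigma$-algebra. Let $\mathbb P$ be a probability measure on $\Omega$ under which the vectors $\omega_i=(\mu_i^L,\dots,\mu_i^1,\lambda_i)$, $i\in\mathbb Z$, are independent and identically distributed. For $\omega\in\Omega$ let $Q=(q_{ij})_{i,j\in\mathbb Z}$ be the conservative $Q$-matrix with $q_{i,i+1}=\lambda_i$, $q_{i,i-l}=\mu_i^l$ for $1\le l\le L$, $q_{ii}=-\big(\lambda_i+\sum_{l=1}^L\mu_i^l\big)$ and $q_{ij}=0$ otherwise. Suppose that (C1) $\mathbb P\big(\lambda_0+\sum_{l=1}^L\mu_0^l>0\big)=1$; (C2) $\mathbb P\Big(\sum_{n=1}^\infty\frac{1}{\lambda_n+\sum_{l=1}^L\mu_n^l}=\infty,\ \sum_{n=-\infty}^0\frac{1}{\max_{1\le k\le L}\{\lambda_{nL-k}+\sum_{l=1}^L\mu_{nL-k}^l\}}=\infty\Big)=1$. A transition matrix on $\mathbb Z$ is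 a family $(p_{ij}(t))_{i,j\in\mathbb Z}$, $t\ge 0$, with $p_{ij}(t)\ge 0$, $\sum_j p_{ij}(t)=1$, $p_{ij}(0)=\delta_{ij}$ and $p_{ij}(s+t)=\sum_k p_{ik}(s)p_{kj}(t)$; it is called a substochastic transition matrix if $\sum_j p_{ij}(t)=1$ is weakened to $\sum_j p_{ij}(t)\le 1$. Then, for $\mathbb P$-a.e. $\omega$, there is exactly one transition matrix $(p_{ij}(t))$ such that $$\lim_{t\to 0^+}\frac{p_{ij}(t)-\delta_{ij}}{t}=q_{ij}\qquad\text{for all } i,j\in\mathbb Z,$$ and it is also the only substochastic transition matrix with this property. -/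

import Mathlib

open MeasureTheory ProbabilityTheory Filter Topology
open scoped NNReal ENNReal

/-- The space of environments `ω = (μ_i^L, …, μ_i^1, lam_i)_{i ∈ ℤ}` with nonnegative entries,
with the product (= Borel) σ-algebra. -/
abbrev Env (L : ℕ) : Type := ℤ → (Fin L → ℝ≥0) × ℝ≥0

namespace Env

/-- The birth rate `lam_i`: the rate of the jump `i → i + 1`. -/
def birth {L : ℕ} (ω : Env L) (i : ℤ) : ℝ≥0 := (ω i).2

/-- The death rate of the jump `i → i - (l + 1)`; thus `death ω i l` is `μ_i^{l+1}`,
`l = 0, …, L - 1`. -/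
def death {L : ℕ} (ω : Env L) (i : ℤ) (l : Fin L) : ℝ≥0 := (ω i).1 l

/-- The total jump rate `lam_i + ∑_{l=1}^L μ_i^l` at the state `i`. -/
def totalRate {L : ℕ} (ω : Env L) (i : ℤ) : ℝ≥0 := ω.birth i + ∑ l, ω.death i l

/-- The maximum of the total rates over the block `{nL - k : 1 ≤ k ≤ L}`. -/
def blockMaxRate {L : ℕ} (ω : Env L) (n : ℤ) : ℝ≥0 :=
  Finset.univ.sup fun k : Fin L => ω.totalRate (n * (L : ℤ) - ((k : ℤ) + 1))

/-- The matrix `Q = (q_{ij})` of the environment `ω`. -/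
def qMatrix {L : ℕ} (ω : Env L) : Matrix ℤ ℤ ℝ := fun i j =>
  if j = i + 1 then (ω.birth i : ℝ)
  else if j = i then -(ω.totalRate i : ℝ)
  else ∑ l : Fin L, if j = i - ((l : ℤ) + 1) then (ω.death i l : ℝ) else 0

end Env

/-- Under `P` the coordinates `(ω_i)_{i ∈ ℤ}` are independent and identically distributed. -/
def IsIIDEnv {L : ℕ} (P : Measure (Env L)) : Prop :=
  iIndepFun (fun (i : ℤ) (ω : Env L) => ω i) P ∧
    ∀ i : ℤ, IdentDistrib (fun ω : Env L => ω i) (fun ω : Env L => ω 0) P P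

/-- (C1): `P(lam_0 + ∑_l μ_0^l > 0) = 1`. -/
def CondC1 {L : ℕ} (P : Measure (Env L)) : Prop :=
  ∀ᵐ ω ∂P, 0 < ω.totalRate 0

/-- (C2): almost surely, the sum over `n ≥ 1` of the reciprocal total rates diverges, and the sum
over `n ≤ 0` of the reciprocal blockwise maximal total rates diverges. The sums are taken in
`[0, ∞]`, with `1 / 0 = ∞`. -/
def CondC2 {L : ℕ} (P : Measure (Env L)) : Prop :=
  ∀ᵐ ω ∂P,
    (∑' m : ℕ, ((ω.totalRate ((m : ℤ) + 1) : ℝ≥0∞))⁻¹ = ∞) ∧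
    (∑' m : ℕ, ((ω.blockMaxRate (-(m : ℤ)) : ℝ≥0∞))⁻¹ = ∞)

/-- A substochastic transition matrix `(p_{ij}(t))_{t ≥ 0}` on the state space `S`: nonnegative
entries, row sums at most `1`, `p(0) = I`, and the Chapman-Kolmogorov equations. -/
structure IsSubTransitionMatrix {S : Type*} [DecidableEq S] (p : ℝ≥0 → Matrix S S ℝ) : Prop where
  nonneg : ∀ t i j, 0 ≤ p t i j
  summable_row : ∀ t i, Summable fun j => p t i j
  row_le_one : ∀ t i, ∑' j, p t i j ≤ 1
  zero : p 0 = 1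
  add : ∀ s t i j, HasSum (fun k => p s i k * p t k j) (p (s + t) i j)

/-- A transition matrix: all row sums are equal to `1`. -/
structure IsTransitionMatrix {S : Type*} [DecidableEq S] (p : ℝ≥0 → Matrix S S ℝ) : Prop
    extends IsSubTransitionMatrix p where
  row_eq_one : ∀ t i, ∑' j, p t i j = 1

/-- `lim_{t → 0+} (p_{ij}(t) - δ_{ij}) / t = q_{ij}` for all `i, j`. -/
def HasQMatrix {S : Type*} [DecidableEq S] (p : ℝ≥0 → Matrix S S ℝ) (Q : Matrix S S ℝ) : Prop :=
  ∀ i j, Tendsto (fun t : ℝ≥0 => (p t i j - (1 : Matrix S S ℝ) i j) / (t : ℝ)) (𝓝[>] 0)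
    (𝓝 (Q i j))

/-! Killing the chain outside a finite set `F` gives the semigroup `exp (t Q_F)`, increasing in `F`;
its supremum is the minimal semigroup. Any substochastic `p` with `Q`-matrix `Q` dominates it: the
`F`-block of `p (t / n)`, raised to the power `n`, is at most `p t` and tends to `exp (t Q_F)` by
Chernoff's formula (`exp_submatrix_le`). If the minimal semigroup is honest, rows of `p` have no
mass left for strict inequality, so it is the unique candidate
(`eq_minimalSemigroup_of_isTransitionMatrix`).

Honesty follows from Reuter's criterion, proved without Laplace transforms. As `F` grows, the dead
time up to `T` decreases to a bounded `w ≥ 0` with `w / T ≤ Q w`, so non-explosion forces `w = 0`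
(`tendsto_deadTime_zero`).

For the environment, a nonzero bounded `w ≥ 0` with `c w ≤ Q w` would increase along a path of
distinct sites whose mean holding times are summable (`exists_path_of_ne_zero`). Such a path is
unbounded above or below. Going up by steps at most 1 it hits every integer above its start; going
down by steps at most `L` it meets every block of length `L` below it. Either way summability
contradicts (C2). -/

/-! ### Chernoff's product formula -/

section Chernoff

variable {𝔸 : Type*} [NormedRing 𝔸]

/-- Telescoping. Only `a` has to be a contraction: for `b = exp (X / n)`, a uniform bound on the
powers is enough. -/
theorem norm_pow_sub_pow_le_of_norm_le_one {a b : 𝔸} {C : ℝ} (ha : ‖a‖ ≤ 1) (n : ℕ)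
    (hb : ∀ k < n, ‖b ^ k‖ ≤ C) : ‖a ^ n - b ^ n‖ ≤ n * (‖a - b‖ * C) := by
  induction n with
  | zero => simp
  | succ n ih =>
    have h1 : a ^ (n + 1) - b ^ (n + 1) = a * (a ^ n - b ^ n) + (a - b) * b ^ n := by
      rw [pow_succ', pow_succ']; noncomm_ring
    have h2 : ‖a * (a ^ n - b ^ n)‖ ≤ n * (‖a - b‖ * C) :=
      (norm_mul_le _ _).trans ((mul_le_of_le_one_left (norm_nonneg _) ha).trans
        (ih fun k hk => hb k (hk.trans n.lt_succ_self)))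
    have h3 : ‖(a - b) * b ^ n‖ ≤ ‖a - b‖ * C :=
      (norm_mul_le _ _).trans
        (mul_le_mul_of_nonneg_left (hb n n.lt_succ_self) (norm_nonneg _))
    rw [h1]
    push_cast
    linarith [norm_add_le (a * (a ^ n - b ^ n)) ((a - b) * b ^ n)]

variable [NormedAlgebra ℝ 𝔸] [CompleteSpace 𝔸]

theorem tendsto_natCast_smul_exp_inv_smul_sub_one (X : 𝔸) :
    Tendsto (fun n : ℕ => (n : ℝ) • (NormedSpace.exp ((n : ℝ)⁻¹ • X) - 1)) atTop (𝓝 X) := by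
  have h := (hasDerivAt_exp_smul_const X (0 : ℝ)).tendsto_slope_zero
  have h0 : Tendsto (fun n : ℕ => (n : ℝ)⁻¹) atTop (𝓝[≠] 0) := by
    refine tendsto_nhdsWithin_iff.2 ⟨tendsto_inv_atTop_nhds_zero_nat, ?_⟩
    filter_upwards [eventually_gt_atTop 0] with n hn
    simpa using hn.ne'
  simpa [Function.comp_def] using h.comp h0

/-- Chernoff's product formula in a Banach algebra. -/
theorem tendsto_pow_exp_of_tendsto_smul_sub_one [NormedAlgebra ℚ 𝔸] {X : 𝔸} {a : ℕ → 𝔸}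
    (ha : ∀ᶠ n in atTop, ‖a n‖ ≤ 1)
    (hX : Tendsto (fun n : ℕ => (n : ℝ) • (a n - 1)) atTop (𝓝 X)) :
    Tendsto (fun n => a n ^ n) atTop (𝓝 (NormedSpace.exp X)) := by
  -- The powers `exp (X / n) ^ k`, `k < n`, all lie on the curve `exp (s X)`, `0 ≤ s ≤ 1`, so one
  -- `C` serves every `n`.
  obtain ⟨C, hC⟩ := (isCompact_Icc (a := (0 : ℝ)) (b := 1)).exists_bound_of_continuousOn
    (f := fun s : ℝ => NormedSpace.exp (s • X))
    (fun s _ => (hasDerivAt_exp_smul_const X s).continuousAt.continuousWithinAt)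
  have hdiff := (hX.sub (tendsto_natCast_smul_exp_inv_smul_sub_one X)).norm.mul_const C
  rw [sub_self, norm_zero, zero_mul] at hdiff
  rw [tendsto_iff_norm_sub_tendsto_zero]
  refine squeeze_zero' (Eventually.of_forall fun _ => norm_nonneg _) ?_ hdiff
  filter_upwards [ha, eventually_gt_atTop 0] with n hn hpos
  have hpos' : (0 : ℝ) < n := Nat.cast_pos.2 hpos
  have hpow : ∀ k : ℕ, NormedSpace.exp ((n : ℝ)⁻¹ • X) ^ k
      = NormedSpace.exp (((k : ℝ) * (n : ℝ)⁻¹) • X) := fun k => by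
    rw [← NormedSpace.exp_nsmul, mul_smul, Nat.cast_smul_eq_nsmul]
  have hexp : NormedSpace.exp ((n : ℝ)⁻¹ • X) ^ n = NormedSpace.exp X := by
    rw [hpow, mul_inv_cancel₀ hpos'.ne', one_smul]
  have key := norm_pow_sub_pow_le_of_norm_le_one (b := NormedSpace.exp ((n : ℝ)⁻¹ • X))
    (C := C) hn n fun k hk => by
      rw [hpow]
      refine hC _ ⟨by positivity, ?_⟩
      rw [← div_eq_mul_inv, div_le_one hpos']
      exact_mod_cast hk.le
  rw [hexp] at key
  refine key.trans_eq ?_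
  rw [← smul_sub, sub_sub_sub_cancel_right, norm_smul, Real.norm_natCast, mul_assoc]

end Chernoff

/-! ### Semigroups on finite state spaces -/

section FiniteState

open scoped Matrix.Norms.Operator

variable {ι : Type*} [Fintype ι]

/-- Off-diagonal entries are nonnegative and row sums are nonpositive. -/
structure Matrix.IsSubGenerator (X : Matrix ι ι ℝ) : Prop where
  offDiag_nonneg : ∀ i j, i ≠ j → 0 ≤ X i j
  row_sum_nonpos : ∀ i, ∑ j, X i j ≤ 0

/-- Entries are nonnegative and row sums are at most one. -/
structure Matrix.IsSubstochastic (A : Matrix ι ι ℝ) : Prop where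
  nonneg : ∀ i j, 0 ≤ A i j
  row_sum_le_one : ∀ i, ∑ j, A i j ≤ 1

namespace Matrix

theorem IsSubstochastic.norm_le_one {A : Matrix ι ι ℝ} (hA : A.IsSubstochastic) : ‖A‖ ≤ 1 := by
  rw [linfty_opNorm_def, ← NNReal.coe_one, NNReal.coe_le_coe]
  refine Finset.sup_le fun i _ => ?_
  rw [← NNReal.coe_le_coe]
  push_cast
  simpa only [Real.norm_eq_abs, abs_of_nonneg (hA.nonneg _ _)] using hA.row_sum_le_one i

theorem IsSubstochastic.mul {A B : Matrix ι ι ℝ} (hA : A.IsSubstochastic)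
    (hB : B.IsSubstochastic) : (A * B).IsSubstochastic where
  nonneg i j := Finset.sum_nonneg fun k _ => mul_nonneg (hA.nonneg i k) (hB.nonneg k j)
  row_sum_le_one i := by
    simp only [mul_apply]
    rw [Finset.sum_comm]
    simp only [← Finset.mul_sum]
    exact (Finset.sum_le_sum fun k _ => mul_le_of_le_one_right (hA.nonneg i k)
      (hB.row_sum_le_one k)).trans (hA.row_sum_le_one i)

theorem isSubstochastic_of_tendsto {a : ℕ → Matrix ι ι ℝ} {A : Matrix ι ι ℝ}
    (ha : ∀ᶠ n in atTop, (a n).IsSubstochastic) (h : Tendsto a atTop (𝓝 A)) :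
    A.IsSubstochastic where
  nonneg i j := ge_of_tendsto ((h.apply_nhds i).apply_nhds j) (ha.mono fun _ hn => hn.nonneg i j)
  row_sum_le_one i :=
    le_of_tendsto (tendsto_finsetSum _ fun j _ => (h.apply_nhds i).apply_nhds j)
      (ha.mono fun _ hn => hn.row_sum_le_one i)

variable [DecidableEq ι]

theorem isSubstochastic_one : (1 : Matrix ι ι ℝ).IsSubstochastic where
  nonneg i j := by rw [one_apply]; split_ifs <;> norm_num
  row_sum_le_one i := by simp [one_apply]

theorem IsSubstochastic.pow {A : Matrix ι ι ℝ} (hA : A.IsSubstochastic) (n : ℕ) :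
    (A ^ n).IsSubstochastic := by
  induction n with
  | zero => simpa using isSubstochastic_one
  | succ n ih => rw [pow_succ]; exact ih.mul hA

theorem IsSubGenerator.isSubstochastic_one_add_smul {X : Matrix ι ι ℝ} (hX : X.IsSubGenerator)
    {h : ℝ} (h0 : 0 ≤ h) (hh : ∀ i, 0 ≤ 1 + h * X i i) : (1 + h • X).IsSubstochastic where
  nonneg i j := by
    by_cases hij : i = j
    · subst hij; simpa using hh i
    · simpa [one_apply_ne hij] using mul_nonneg h0 (hX.offDiag_nonneg i j hij)
  row_sum_le_one i := by
    simp only [add_apply, smul_apply, smul_eq_mul, Finset.sum_add_distrib, ← Finset.mul_sum]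
    have : ∑ j, (1 : Matrix ι ι ℝ) i j = 1 := by simp [one_apply]
    nlinarith [hX.row_sum_nonpos i]

/-- Euler's limit `(1 + t X / n) ^ n`: for large `n` the diagonal of each factor is nonnegative, so
the factors are substochastic. -/
theorem IsSubGenerator.isSubstochastic_exp {X : Matrix ι ι ℝ} (hX : X.IsSubGenerator)
    {t : ℝ} (ht : 0 ≤ t) : (NormedSpace.exp (t • X)).IsSubstochastic := by
  have hsub : ∀ᶠ n : ℕ in atTop, (1 + (n : ℝ)⁻¹ • t • X).IsSubstochastic := by
    have h1 : ∀ᶠ n : ℕ in atTop, ∀ i, 0 < 1 + ((n : ℝ)⁻¹ * t) * X i i := by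
      refine eventually_all.2 fun i => ?_
      have : Tendsto (fun n : ℕ => 1 + ((n : ℝ)⁻¹ * t) * X i i) atTop
          (𝓝 (1 + 0 * t * X i i)) :=
        ((tendsto_inv_atTop_nhds_zero_nat.mul_const t).mul_const _).const_add 1
      exact this.eventually_const_lt (by norm_num)
    filter_upwards [h1] with n hn
    rw [smul_smul]
    exact hX.isSubstochastic_one_add_smul (by positivity) fun i => (hn i).le
  refine isSubstochastic_of_tendsto (hsub.mono fun n hn => hn.pow n)
    (tendsto_pow_exp_of_tendsto_smul_sub_one (hsub.mono fun n hn => hn.norm_le_one) ?_)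
  refine tendsto_const_nhds.congr' ?_
  filter_upwards [eventually_gt_atTop 0] with n hn
  have : (n : ℝ) ≠ 0 := by positivity
  rw [add_sub_cancel_left, smul_smul, mul_inv_cancel₀ this, one_smul]

/-- The backward equation; with `X` on the left, `j` can later be summed out to give an equation for
the survival probability. -/
theorem hasDerivAt_exp_smul_apply (X : Matrix ι ι ℝ) (t : ℝ) (i j : ι) :
    HasDerivAt (fun s : ℝ => NormedSpace.exp (s • X) i j)
      (∑ k, X i k * NormedSpace.exp (t • X) k j) t := by
  have h := hasDerivAt_exp_smul_const' X t
  exact hasDerivAt_pi.1 (hasDerivAt_pi.1 h i) j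

theorem exp_add_smul (X : Matrix ι ι ℝ) (s t : ℝ) :
    NormedSpace.exp ((s + t) • X) = NormedSpace.exp (s • X) * NormedSpace.exp (t • X) := by
  rw [add_smul]
  exact NormedSpace.exp_add_of_commute (((Commute.refl X).smul_left s).smul_right t)

theorem tendsto_exp_smul_sub_one_div (X : Matrix ι ι ℝ) (i j : ι) :
    Tendsto (fun t : ℝ≥0 => (NormedSpace.exp ((t : ℝ) • X) i j - (1 : Matrix ι ι ℝ) i j) / (t : ℝ))
      (𝓝[>] 0) (𝓝 (X i j)) := by
  have h := (hasDerivAt_exp_smul_apply X 0 i j).tendsto_slope_zero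
  have h0 : Tendsto (fun t : ℝ≥0 => (t : ℝ)) (𝓝[>] 0) (𝓝[≠] 0) := by
    refine tendsto_nhdsWithin_iff.2
      ⟨(NNReal.continuous_coe.tendsto' 0 0 rfl).mono_left nhdsWithin_le_nhds, ?_⟩
    filter_upwards [self_mem_nhdsWithin] with t ht
    exact (NNReal.coe_pos.2 ht).ne'
  simpa [Function.comp_def, one_apply, div_eq_inv_mul] using h.comp h0

theorem IsSubGenerator.isSubTransitionMatrix_exp {X : Matrix ι ι ℝ} (hX : X.IsSubGenerator) :
    IsSubTransitionMatrix fun t : ℝ≥0 => NormedSpace.exp ((t : ℝ) • X) where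
  nonneg t := (hX.isSubstochastic_exp t.2).nonneg
  summable_row t i := Summable.of_finite
  row_le_one t i := by
    rw [tsum_fintype]; exact (hX.isSubstochastic_exp t.2).row_sum_le_one i
  zero := by simp
  add s t i j := by
    rw [NNReal.coe_add, exp_add_smul, mul_apply]
    exact hasSum_fintype _

end Matrix

variable {S : Type*} [DecidableEq S]

theorem IsSubTransitionMatrix.isSubstochastic_submatrix {p : ℝ≥0 → Matrix S S ℝ}
    (hp : IsSubTransitionMatrix p) {e : ι → S} (he : Function.Injective e) (t : ℝ≥0) :
    ((p t).submatrix e e).IsSubstochastic where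
  nonneg i j := hp.nonneg t _ _
  row_sum_le_one i := by
    have h := (hp.summable_row t (e i)).sum_le_tsum (Finset.univ.map ⟨e, he⟩)
      fun j _ => hp.nonneg t _ j
    rw [Finset.sum_map] at h
    exact h.trans (hp.row_le_one t (e i))

variable [DecidableEq ι]

/-- The power of the block counts only paths that are in the range of `e` at each multiple of `t`;
Chapman-Kolmogorov sums over all paths. -/
theorem IsSubTransitionMatrix.submatrix_pow_le {p : ℝ≥0 → Matrix S S ℝ}
    (hp : IsSubTransitionMatrix p) {e : ι → S} (he : Function.Injective e) (t : ℝ≥0) (n : ℕ)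
    (i j : ι) : ((p t).submatrix e e ^ n) i j ≤ p (n * t) (e i) (e j) := by
  induction n generalizing i j with
  | zero =>
    rw [Nat.cast_zero, zero_mul, hp.zero, pow_zero, Matrix.one_apply, Matrix.one_apply]
    simp only [he.eq_iff, le_refl]
  | succ n ih =>
    rw [pow_succ, Matrix.mul_apply, Nat.cast_succ, add_mul, one_mul]
    refine (Finset.sum_le_sum fun k _ => mul_le_mul_of_nonneg_right (ih i k)
      (hp.nonneg t (e k) (e j))).trans ?_
    have h := sum_le_hasSum (Finset.univ.map ⟨e, he⟩)
      (fun k _ => mul_nonneg (hp.nonneg _ (e i) k) (hp.nonneg _ k (e j)))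
      (hp.add (n * t) t (e i) (e j))
    rwa [Finset.sum_map] at h

/-- A substochastic transition matrix dominates the transition matrices killed outside finite
sets. -/
theorem IsSubTransitionMatrix.exp_submatrix_le {p : ℝ≥0 → Matrix S S ℝ} {Q : Matrix S S ℝ}
    (hp : IsSubTransitionMatrix p) (hQ : HasQMatrix p Q) {e : ι → S}
    (he : Function.Injective e) (t : ℝ≥0) (i j : ι) :
    NormedSpace.exp ((t : ℝ) • Q.submatrix e e) i j ≤ p t (e i) (e j) := by
  rcases eq_or_ne t 0 with rfl | ht
  · simp [hp.zero, Matrix.one_apply, he.eq_iff]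
  have hlim : Tendsto (fun n : ℕ => (p (t / n)).submatrix e e ^ n) atTop
      (𝓝 (NormedSpace.exp ((t : ℝ) • Q.submatrix e e))) := by
    refine tendsto_pow_exp_of_tendsto_smul_sub_one
      (Eventually.of_forall fun n => (hp.isSubstochastic_submatrix he _).norm_le_one) ?_
    have h0 : Tendsto (fun n : ℕ => t / (n : ℝ≥0)) atTop (𝓝[>] 0) := by
      refine tendsto_nhdsWithin_iff.2 ⟨?_, ?_⟩
      · have := tendsto_inv_atTop_nhds_zero_nat (𝕜 := ℝ≥0) |>.const_mul t
        simpa [div_eq_mul_inv] using this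
      · filter_upwards [eventually_gt_atTop 0] with n hn
        exact div_pos (pos_iff_ne_zero.2 ht) (Nat.cast_pos.2 hn)
    refine tendsto_pi_nhds.2 fun k => tendsto_pi_nhds.2 fun l => ?_
    have h := ((hQ (e k) (e l)).comp h0).const_mul (t : ℝ)
    refine h.congr' ?_
    filter_upwards [eventually_gt_atTop 0] with n hn
    have ht' : (t : ℝ) ≠ 0 := by exact_mod_cast ht
    have hn' : (n : ℝ) ≠ 0 := by positivity
    simp only [Function.comp_apply, NNReal.coe_div, NNReal.coe_natCast, Matrix.smul_apply,
      Matrix.sub_apply, Matrix.submatrix_apply, smul_eq_mul, Matrix.one_apply, he.eq_iff]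
    field_simp
  refine le_of_tendsto ((hlim.apply_nhds i).apply_nhds j) ?_
  filter_upwards [eventually_gt_atTop 0] with n hn
  have hn' : (n : ℝ≥0) ≠ 0 := by positivity
  have h := hp.submatrix_pow_le he (t / n) n i j
  rwa [mul_div_cancel₀ _ hn'] at h

end FiniteState

/-! ### Killed semigroups and the minimal semigroup -/

section MinimalSemigroup

variable {S : Type*}

/-- A row-finite conservative `Q`-matrix; the support of the row `i` is contained in `R i`. -/
structure IsRowFiniteConservative (Q : Matrix S S ℝ) (R : S → Finset S) : Prop where
  offDiag_nonneg : ∀ i j, i ≠ j → 0 ≤ Q i j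
  apply_eq_zero : ∀ i j, j ∉ R i → Q i j = 0
  row_sum_eq_zero : ∀ i, ∑ j ∈ R i, Q i j = 0

theorem IsRowFiniteConservative.sum_eq_of_subset {Q : Matrix S S ℝ} {R : S → Finset S}
    (hQ : IsRowFiniteConservative Q R) (i : S) {G : Finset S} (hG : R i ⊆ G) (w : S → ℝ) :
    ∑ j ∈ R i, Q i j * w j = ∑ j ∈ G, Q i j * w j :=
  Finset.sum_subset hG fun j _ hj => by rw [hQ.apply_eq_zero i j hj, zero_mul]

variable [DecidableEq S]

theorem IsRowFiniteConservative.sum_nonpos {Q : Matrix S S ℝ} {R : S → Finset S}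
    (hQ : IsRowFiniteConservative Q R) {i : S} {F : Finset S} (hi : i ∈ F) :
    ∑ j ∈ F, Q i j ≤ 0 := by
  have h := hQ.sum_eq_of_subset i (Finset.subset_union_right (s₁ := F)) 1
  simp only [Pi.one_apply, mul_one, hQ.row_sum_eq_zero] at h
  rw [h]
  refine Finset.sum_le_sum_of_subset_of_nonneg Finset.subset_union_left fun j _ hj => ?_
  exact hQ.offDiag_nonneg i j fun hij => hj (hij ▸ hi)

theorem IsRowFiniteConservative.isSubGenerator_submatrix {Q : Matrix S S ℝ} {R : S → Finset S}
    (hQ : IsRowFiniteConservative Q R) (F : Finset S) :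
    (Q.submatrix (Subtype.val : F → S) Subtype.val).IsSubGenerator where
  offDiag_nonneg i j hij := hQ.offDiag_nonneg _ _ fun h => hij (Subtype.ext h)
  row_sum_nonpos i := by
    simpa only [Matrix.submatrix_apply, Finset.sum_coe_sort F (fun j => Q i j)]
      using hQ.sum_nonpos i.2

open scoped Matrix.Norms.Operator in
/-- The semigroup generated by `Q` killed upon leaving the finite set `F`. -/
noncomputable def killedSemigroup (Q : Matrix S S ℝ) (F : Finset S) (t : ℝ) : Matrix S S ℝ :=
  fun i j => if h : i ∈ F ∧ j ∈ F then
    NormedSpace.exp (t • Q.submatrix (Subtype.val : F → S) Subtype.val) ⟨i, h.1⟩ ⟨j, h.2⟩ else 0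

open scoped Matrix.Norms.Operator in
theorem killedSemigroup_coe (Q : Matrix S S ℝ) (F : Finset S) (t : ℝ) (i j : F) :
    killedSemigroup Q F t i j =
      NormedSpace.exp (t • Q.submatrix (Subtype.val : F → S) Subtype.val) i j := by
  simp [killedSemigroup]

theorem killedSemigroup_left_notMem (Q : Matrix S S ℝ) {F : Finset S} (t : ℝ) {i : S}
    (hi : i ∉ F) (j : S) : killedSemigroup Q F t i j = 0 := by
  simp [killedSemigroup, hi]

theorem killedSemigroup_right_notMem (Q : Matrix S S ℝ) {F : Finset S} (t : ℝ) (i : S) {j : S}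
    (hj : j ∉ F) : killedSemigroup Q F t i j = 0 := by
  simp [killedSemigroup, hj]

theorem hasDerivAt_killedSemigroup (Q : Matrix S S ℝ) {F : Finset S} (t : ℝ) {i : S}
    (hi : i ∈ F) (j : S) :
    HasDerivAt (fun s => killedSemigroup Q F s i j)
      (∑ k ∈ F, Q i k * killedSemigroup Q F t k j) t := by
  by_cases hj : j ∈ F
  · lift i to F using hi
    lift j to F using hj
    rw [← Finset.sum_coe_sort F fun k => Q i k * killedSemigroup Q F t k j]
    simp only [killedSemigroup_coe]
    exact Matrix.hasDerivAt_exp_smul_apply _ t i j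
  · simp only [killedSemigroup_right_notMem Q _ _ hj, mul_zero, Finset.sum_const_zero]
    exact hasDerivAt_const t 0

theorem tendsto_killedSemigroup_sub_one_div (Q : Matrix S S ℝ) {F : Finset S} {i j : S}
    (hi : i ∈ F) (hj : j ∈ F) :
    Tendsto (fun t : ℝ≥0 => (killedSemigroup Q F t i j - (1 : Matrix S S ℝ) i j) / (t : ℝ))
      (𝓝[>] 0) (𝓝 (Q i j)) := by
  lift i to F using hi
  lift j to F using hj
  simpa only [killedSemigroup_coe, Matrix.one_apply, Subtype.ext_iff, Matrix.submatrix_apply] using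
    Matrix.tendsto_exp_smul_sub_one_div (Q.submatrix (Subtype.val : F → S) Subtype.val) i j

theorem killedSemigroup_add (Q : Matrix S S ℝ) (F : Finset S) (s t : ℝ) (i j : S) :
    killedSemigroup Q F (s + t) i j =
      ∑ k ∈ F, killedSemigroup Q F s i k * killedSemigroup Q F t k j := by
  by_cases hi : i ∈ F
  · by_cases hj : j ∈ F
    · lift i to F using hi
      lift j to F using hj
      rw [← Finset.sum_coe_sort F fun k => killedSemigroup Q F s i k * killedSemigroup Q F t k j]
      simp only [killedSemigroup_coe, Matrix.exp_add_smul, Matrix.mul_apply]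
    · simp [killedSemigroup_right_notMem Q _ _ hj]
  · simp [killedSemigroup_left_notMem Q _ hi]

theorem killedSemigroup_zero (Q : Matrix S S ℝ) {F : Finset S} {i : S} (hi : i ∈ F) (j : S) :
    killedSemigroup Q F 0 i j = (1 : Matrix S S ℝ) i j := by
  by_cases hj : j ∈ F
  · lift i to F using hi
    lift j to F using hj
    rw [killedSemigroup_coe, zero_smul, NormedSpace.exp_zero]
    simp only [Matrix.one_apply, Subtype.ext_iff]
  · rw [killedSemigroup_right_notMem Q _ _ hj, Matrix.one_apply_ne]
    rintro rfl
    exact hj hi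

theorem killedSemigroup_le {Q : Matrix S S ℝ} {p : ℝ≥0 → Matrix S S ℝ}
    (hp : IsSubTransitionMatrix p) (hpQ : HasQMatrix p Q) (F : Finset S) (t : ℝ≥0) (i j : S) :
    killedSemigroup Q F t i j ≤ p t i j := by
  by_cases hi : i ∈ F
  · by_cases hj : j ∈ F
    · lift i to F using hi
      lift j to F using hj
      rw [killedSemigroup_coe]
      exact hp.exp_submatrix_le hpQ Subtype.val_injective t i j
    · simpa [killedSemigroup_right_notMem Q _ _ hj] using hp.nonneg t _ _
  · simpa [killedSemigroup_left_notMem Q _ hi] using hp.nonneg t _ _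

/-- The minimal semigroup of `Q`, the limit of the semigroups killed outside finite sets. -/
noncomputable def minimalSemigroup (Q : Matrix S S ℝ) (t : ℝ≥0) : Matrix S S ℝ :=
  fun i j => ⨆ F : Finset S, killedSemigroup Q F t i j

/-- The probability that the chain killed upon leaving `F` is alive at time `t`. -/
noncomputable def survival (Q : Matrix S S ℝ) (F : Finset S) (t : ℝ) (i : S) : ℝ :=
  ∑ j ∈ F, killedSemigroup Q F t i j

theorem survival_notMem (Q : Matrix S S ℝ) {F : Finset S} (t : ℝ) {i : S} (hi : i ∉ F) :
    survival Q F t i = 0 := by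
  simp [survival, killedSemigroup_left_notMem Q _ hi]

theorem survival_zero (Q : Matrix S S ℝ) {F : Finset S} {i : S} (hi : i ∈ F) :
    survival Q F 0 i = 1 := by
  simp [survival, killedSemigroup_zero Q hi, Matrix.one_apply, hi]

theorem hasDerivAt_survival (Q : Matrix S S ℝ) {F : Finset S} (t : ℝ) {i : S} (hi : i ∈ F) :
    HasDerivAt (fun s => survival Q F s i) (∑ k ∈ F, Q i k * survival Q F t k) t := by
  have h := HasDerivAt.fun_sum fun j (_ : j ∈ F) => hasDerivAt_killedSemigroup Q t hi j
  rw [Finset.sum_comm] at h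
  simpa only [survival, Finset.mul_sum] using h

theorem continuous_survival (Q : Matrix S S ℝ) (F : Finset S) (i : S) :
    Continuous fun t => survival Q F t i := by
  by_cases hi : i ∈ F
  · exact continuous_iff_continuousAt.2 fun t => (hasDerivAt_survival Q t hi).continuousAt
  · simp only [survival_notMem Q _ hi, continuous_const]

namespace IsRowFiniteConservative

variable {Q : Matrix S S ℝ} {R : S → Finset S}

theorem killedSemigroup_nonneg (hQ : IsRowFiniteConservative Q R) (F : Finset S) {t : ℝ}
    (ht : 0 ≤ t) (i j : S) : 0 ≤ killedSemigroup Q F t i j := by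
  unfold killedSemigroup
  split_ifs with h
  · exact ((hQ.isSubGenerator_submatrix F).isSubstochastic_exp ht).nonneg _ _
  · exact le_rfl

theorem survival_le_one (hQ : IsRowFiniteConservative Q R) (F : Finset S) {t : ℝ} (ht : 0 ≤ t)
    (i : S) : survival Q F t i ≤ 1 := by
  by_cases hi : i ∈ F
  · lift i to F using hi
    rw [survival, ← Finset.sum_coe_sort F fun j => killedSemigroup Q F t i j]
    simp only [killedSemigroup_coe]
    exact ((hQ.isSubGenerator_submatrix F).isSubstochastic_exp ht).row_sum_le_one i
  · simp [survival_notMem Q t hi]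

theorem sum_killedSemigroup_le_survival (hQ : IsRowFiniteConservative Q R) (F G : Finset S)
    {t : ℝ} (ht : 0 ≤ t) (i : S) : ∑ j ∈ G, killedSemigroup Q F t i j ≤ survival Q F t i := by
  have h : survival Q F t i = ∑ j ∈ F ∪ G, killedSemigroup Q F t i j :=
    Finset.sum_subset Finset.subset_union_left
      fun j _ hj => killedSemigroup_right_notMem Q t i hj
  rw [h]
  exact Finset.sum_le_sum_of_subset_of_nonneg Finset.subset_union_right
    fun j _ _ => hQ.killedSemigroup_nonneg F ht i j

theorem killedSemigroup_le_one (hQ : IsRowFiniteConservative Q R) (F : Finset S) {t : ℝ}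
    (ht : 0 ≤ t) (i j : S) : killedSemigroup Q F t i j ≤ 1 := by
  simpa using (hQ.sum_killedSemigroup_le_survival F {j} ht i).trans (hQ.survival_le_one F ht i)

/-- The semigroup killed outside `G` is itself substochastic on `G` with generator `Q_G`, so
domination applies to the inclusion `F → G`. -/
theorem killedSemigroup_mono (hQ : IsRowFiniteConservative Q R) {t : ℝ} (ht : 0 ≤ t) (i j : S) :
    Monotone fun F => killedSemigroup Q F t i j := by
  intro F G hFG
  dsimp only
  lift t to ℝ≥0 using ht
  by_cases hi : i ∈ F
  · by_cases hj : j ∈ F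
    · lift i to F using hi
      lift j to F using hj
      have hG := (hQ.isSubGenerator_submatrix G).isSubTransitionMatrix_exp
      have h := hG.exp_submatrix_le (Matrix.tendsto_exp_smul_sub_one_div _)
        (Set.inclusion_injective (show (F : Set S) ⊆ G from hFG)) t i j
      rw [killedSemigroup_coe, killedSemigroup, dif_pos ⟨hFG i.2, hFG j.2⟩]
      exact h
    · rw [killedSemigroup_right_notMem Q _ _ hj]
      exact hQ.killedSemigroup_nonneg G t.2 i j
  · rw [killedSemigroup_left_notMem Q _ hi]
    exact hQ.killedSemigroup_nonneg G t.2 i j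

theorem survival_mono (hQ : IsRowFiniteConservative Q R) {t : ℝ} (ht : 0 ≤ t) (i : S) :
    Monotone fun F => survival Q F t i := fun F G hFG =>
  (Finset.sum_le_sum fun j _ => hQ.killedSemigroup_mono ht i j hFG).trans
    (hQ.sum_killedSemigroup_le_survival G F ht i)

theorem survival_antitoneOn (hQ : IsRowFiniteConservative Q R) (F : Finset S) (i : S) :
    AntitoneOn (fun t => survival Q F t i) (Set.Ici 0) := by
  intro s hs t _ hst
  dsimp only
  have hs : 0 ≤ s := hs
  have h : survival Q F t i = ∑ k ∈ F, killedSemigroup Q F s i k * survival Q F (t - s) k := by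
    simp only [survival, Finset.mul_sum]
    rw [Finset.sum_comm]
    simp only [← killedSemigroup_add, add_sub_cancel]
  rw [h]
  exact Finset.sum_le_sum fun k _ => mul_le_of_le_one_right (hQ.killedSemigroup_nonneg F hs i k)
    (hQ.survival_le_one F (sub_nonneg.2 hst) k)

theorem bddAbove_killedSemigroup (hQ : IsRowFiniteConservative Q R) (t : ℝ≥0) (i j : S) :
    BddAbove (Set.range fun F => killedSemigroup Q F t i j) :=
  ⟨1, by rintro _ ⟨F, rfl⟩; exact hQ.killedSemigroup_le_one F t.2 i j⟩

theorem killedSemigroup_le_minimalSemigroup (hQ : IsRowFiniteConservative Q R) (F : Finset S)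
    (t : ℝ≥0) (i j : S) : killedSemigroup Q F t i j ≤ minimalSemigroup Q t i j :=
  le_ciSup (hQ.bddAbove_killedSemigroup t i j) F

theorem tendsto_killedSemigroup (hQ : IsRowFiniteConservative Q R) (t : ℝ≥0) (i j : S) :
    Tendsto (fun F => killedSemigroup Q F t i j) atTop (𝓝 (minimalSemigroup Q t i j)) :=
  tendsto_atTop_ciSup (hQ.killedSemigroup_mono t.2 i j) (hQ.bddAbove_killedSemigroup t i j)

theorem minimalSemigroup_nonneg (hQ : IsRowFiniteConservative Q R) (t : ℝ≥0) (i j : S) :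
    0 ≤ minimalSemigroup Q t i j :=
  (hQ.killedSemigroup_nonneg ∅ t.2 i j).trans (hQ.killedSemigroup_le_minimalSemigroup ∅ t i j)

theorem sum_minimalSemigroup_le_one (hQ : IsRowFiniteConservative Q R) (t : ℝ≥0) (i : S)
    (G : Finset S) : ∑ j ∈ G, minimalSemigroup Q t i j ≤ 1 :=
  le_of_tendsto (tendsto_finsetSum _ fun j _ => hQ.tendsto_killedSemigroup t i j)
    (Eventually.of_forall fun F =>
      (hQ.sum_killedSemigroup_le_survival F G t.2 i).trans (hQ.survival_le_one F t.2 i))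

theorem summable_minimalSemigroup (hQ : IsRowFiniteConservative Q R) (t : ℝ≥0) (i : S) :
    Summable fun j => minimalSemigroup Q t i j :=
  summable_of_sum_le (hQ.minimalSemigroup_nonneg t i) (hQ.sum_minimalSemigroup_le_one t i)

theorem minimalSemigroup_le_one (hQ : IsRowFiniteConservative Q R) (t : ℝ≥0) (i j : S) :
    minimalSemigroup Q t i j ≤ 1 := by
  simpa using hQ.sum_minimalSemigroup_le_one t i {j}

/-- Dominated convergence in the killed Chapman-Kolmogorov equation; the summable row
`minimalSemigroup Q s i` is the dominating function. -/
theorem hasSum_minimalSemigroup_mul (hQ : IsRowFiniteConservative Q R) (s t : ℝ≥0) (i j : S) :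
    HasSum (fun k => minimalSemigroup Q s i k * minimalSemigroup Q t k j)
      (minimalSemigroup Q (s + t) i j) := by
  have hle : ∀ k, minimalSemigroup Q s i k * minimalSemigroup Q t k j ≤ minimalSemigroup Q s i k :=
    fun k => mul_le_of_le_one_right (hQ.minimalSemigroup_nonneg s i k)
      (hQ.minimalSemigroup_le_one t k j)
  have hsum : Summable fun k => minimalSemigroup Q s i k * minimalSemigroup Q t k j :=
    Summable.of_nonneg_of_le (fun k => mul_nonneg (hQ.minimalSemigroup_nonneg s i k)
      (hQ.minimalSemigroup_nonneg t k j)) hle (hQ.summable_minimalSemigroup s i)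
  have hlim : Tendsto (fun F => ∑' k, killedSemigroup Q F s i k * killedSemigroup Q F t k j) atTop
      (𝓝 (∑' k, minimalSemigroup Q s i k * minimalSemigroup Q t k j)) := by
    refine tendsto_tsum_of_dominated_convergence (hQ.summable_minimalSemigroup s i)
      (fun k => (hQ.tendsto_killedSemigroup s i k).mul (hQ.tendsto_killedSemigroup t k j))
      (Eventually.of_forall fun F k => ?_)
    have h1 := hQ.killedSemigroup_nonneg F s.2 i k
    have h2 := hQ.killedSemigroup_nonneg F t.2 k j
    exact (Real.norm_of_nonneg (mul_nonneg h1 h2)).trans_le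
      ((mul_le_of_le_one_right h1 (hQ.killedSemigroup_le_one F t.2 k j)).trans
        (hQ.killedSemigroup_le_minimalSemigroup F s i k))
  have heq : ∀ F, ∑' k, killedSemigroup Q F s i k * killedSemigroup Q F t k j
      = killedSemigroup Q F ((s + t : ℝ≥0) : ℝ) i j := fun F => by
    rw [NNReal.coe_add, killedSemigroup_add]
    exact tsum_eq_sum fun k hk => by rw [killedSemigroup_right_notMem Q _ _ hk, zero_mul]
  simp only [heq] at hlim
  rw [tendsto_nhds_unique (hQ.tendsto_killedSemigroup (s + t) i j) hlim]
  exact hsum.hasSum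

theorem minimalSemigroup_zero (hQ : IsRowFiniteConservative Q R) : minimalSemigroup Q 0 = 1 := by
  ext i j
  refine tendsto_nhds_unique (hQ.tendsto_killedSemigroup 0 i j)
    (tendsto_const_nhds.congr' ?_)
  filter_upwards [eventually_ge_atTop {i}] with F hF
  rw [NNReal.coe_zero, killedSemigroup_zero Q (Finset.singleton_subset_iff.1 hF)]

theorem isSubTransitionMatrix_minimalSemigroup (hQ : IsRowFiniteConservative Q R) :
    IsSubTransitionMatrix (minimalSemigroup Q) where
  nonneg := hQ.minimalSemigroup_nonneg
  summable_row := hQ.summable_minimalSemigroup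
  row_le_one t i := Real.tsum_le_of_sum_le (hQ.minimalSemigroup_nonneg t i)
    (hQ.sum_minimalSemigroup_le_one t i)
  zero := hQ.minimalSemigroup_zero
  add := hQ.hasSum_minimalSemigroup_mul

/-- A squeeze. The killed semigroup bounds the entry `j` from below; since the row sum is at most 1,
the killed entries `k ≠ j` bound it from above. With the support of row `i` inside `F`,
conservativity makes both slopes tend to `Q i j`. -/
theorem hasQMatrix_minimalSemigroup (hQ : IsRowFiniteConservative Q R) :
    HasQMatrix (minimalSemigroup Q) Q := by
  intro i j
  set F : Finset S := insert i (insert j (R i))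
  have hi : i ∈ F := by simp [F]
  have hj : j ∈ F := by simp [F]
  have hR : R i ⊆ F := fun k hk => by simp [F, hk]
  have hQF : Q i j = -∑ k ∈ F.erase j, Q i k := by
    have h := hQ.sum_eq_of_subset i hR 1
    simp only [Pi.one_apply, mul_one, hQ.row_sum_eq_zero] at h
    rw [← Finset.add_sum_erase F _ hj] at h
    linarith
  have hone : (1 : Matrix S S ℝ) i j = 1 - ∑ k ∈ F.erase j, (1 : Matrix S S ℝ) i k := by
    rw [eq_sub_iff_add_eq, Finset.add_sum_erase F _ hj]
    simp [Matrix.one_apply, hi]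
  have hupper : Tendsto (fun t : ℝ≥0 =>
      -∑ k ∈ F.erase j, (killedSemigroup Q F t i k - (1 : Matrix S S ℝ) i k) / (t : ℝ))
      (𝓝[>] 0) (𝓝 (Q i j)) := by
    rw [hQF]
    exact (tendsto_finsetSum _ fun k hk =>
      tendsto_killedSemigroup_sub_one_div Q hi (Finset.mem_of_mem_erase hk)).neg
  refine tendsto_of_tendsto_of_tendsto_of_le_of_le
    (tendsto_killedSemigroup_sub_one_div Q hi hj) hupper (fun t => ?_) fun t => ?_
  · dsimp only
    gcongr
    exact hQ.killedSemigroup_le_minimalSemigroup F t i j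
  · dsimp only
    rw [← Finset.sum_div, ← neg_div]
    gcongr
    have h1 := hQ.sum_minimalSemigroup_le_one t i F
    rw [← Finset.add_sum_erase F _ hj] at h1
    have h2 : ∑ k ∈ F.erase j, killedSemigroup Q F t i k
        ≤ ∑ k ∈ F.erase j, minimalSemigroup Q t i k :=
      Finset.sum_le_sum fun k _ => hQ.killedSemigroup_le_minimalSemigroup F t i k
    rw [Finset.sum_sub_distrib, hone]
    linarith

end IsRowFiniteConservative

theorem minimalSemigroup_le {Q : Matrix S S ℝ} {p : ℝ≥0 → Matrix S S ℝ}
    (hp : IsSubTransitionMatrix p) (hpQ : HasQMatrix p Q) (t : ℝ≥0) (i j : S) :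
    minimalSemigroup Q t i j ≤ p t i j :=
  ciSup_le fun F => killedSemigroup_le hp hpQ F t i j

/-- An honest minimal semigroup is the only substochastic one with its `Q`-matrix. -/
theorem eq_minimalSemigroup_of_isTransitionMatrix {Q : Matrix S S ℝ}
    (hQ : IsTransitionMatrix (minimalSemigroup Q)) {p : ℝ≥0 → Matrix S S ℝ}
    (hp : IsSubTransitionMatrix p) (hpQ : HasQMatrix p Q) : p = minimalSemigroup Q := by
  ext t i j
  refine le_antisymm ?_ (minimalSemigroup_le hp hpQ t i j)
  by_contra! hlt
  have h := Summable.tsum_lt_tsum (minimalSemigroup_le hp hpQ t i) hlt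
    (hQ.summable_row t i) (hp.summable_row t i)
  rw [hQ.row_eq_one] at h
  exact h.not_ge (hp.row_le_one t i)

/-! ### Non-explosion implies honesty -/

/-- Reuter's non-explosion condition: no nonzero bounded nonnegative `w` satisfies `c w ≤ Q w`. -/
def IsNonexplosive (Q : Matrix S S ℝ) (R : S → Finset S) : Prop :=
  ∀ (c B : ℝ) (w : S → ℝ), 0 < c → (∀ i, 0 ≤ w i) → (∀ i, w i ≤ B) →
    (∀ i, c * w i ≤ ∑ j ∈ R i, Q i j * w j) → w = 0

/-- The expected time that the chain killed upon leaving `F` has been dead by the time `T`. -/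
noncomputable def deadTime (Q : Matrix S S ℝ) (F : Finset S) (T : ℝ) (i : S) : ℝ :=
  ∫ t in (0 : ℝ)..T, (1 - survival Q F t i)

theorem intervalIntegrable_one_sub_survival (Q : Matrix S S ℝ) (F : Finset S) (i : S) (a b : ℝ) :
    IntervalIntegrable (fun t => 1 - survival Q F t i) volume a b :=
  (continuous_const.sub (continuous_survival Q F i)).intervalIntegrable a b

theorem deadTime_eq (Q : Matrix S S ℝ) (F : Finset S) (T : ℝ) (i : S) :
    deadTime Q F T i = T - ∫ t in (0 : ℝ)..T, survival Q F t i := by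
  rw [deadTime, intervalIntegral.integral_sub intervalIntegrable_const
    ((continuous_survival Q F i).intervalIntegrable _ _)]
  simp

namespace IsRowFiniteConservative

variable {Q : Matrix S S ℝ} {R : S → Finset S}

theorem deadTime_nonneg (hQ : IsRowFiniteConservative Q R) (F : Finset S) {T : ℝ} (hT : 0 ≤ T)
    (i : S) : 0 ≤ deadTime Q F T i :=
  intervalIntegral.integral_nonneg hT fun _ ht => sub_nonneg.2 (hQ.survival_le_one F ht.1 i)

theorem deadTime_antitone (hQ : IsRowFiniteConservative Q R) {T : ℝ} (hT : 0 ≤ T) (i : S) :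
    Antitone fun F => deadTime Q F T i := fun F G hFG =>
  intervalIntegral.integral_mono_on hT (intervalIntegrable_one_sub_survival Q G i 0 T)
    (intervalIntegrable_one_sub_survival Q F i 0 T)
    fun _ ht => sub_le_sub_left (hQ.survival_mono ht.1 i hFG) 1

/-- The integrand increases in time, so its final value bounds it. Combined with `sum_mul_deadTime`,
this is the inequality `w / T ≤ Q w` before the limit. -/
theorem deadTime_le_mul (hQ : IsRowFiniteConservative Q R) (F : Finset S) {T : ℝ} (hT : 0 ≤ T)
    (i : S) : deadTime Q F T i ≤ T * (1 - survival Q F T i) := by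
  have h := intervalIntegral.integral_mono_on hT (intervalIntegrable_one_sub_survival Q F i 0 T)
    intervalIntegrable_const
    fun t ht => sub_le_sub_left (hQ.survival_antitoneOn F i ht.1 (ht.1.trans ht.2) ht.2) 1
  rwa [intervalIntegral.integral_const, sub_zero, smul_eq_mul] at h

theorem one_sub_survival_le_deadTime (hQ : IsRowFiniteConservative Q R) (F : Finset S) {t : ℝ}
    (ht : 0 ≤ t) (i : S) : 1 - survival Q F t i ≤ deadTime Q F (t + 1) i := by
  have hadd : deadTime Q F (t + 1) i
      = deadTime Q F t i + ∫ s in t..(t + 1), (1 - survival Q F s i) :=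
    (intervalIntegral.integral_add_adjacent_intervals
      (intervalIntegrable_one_sub_survival Q F i 0 t)
      (intervalIntegrable_one_sub_survival Q F i t (t + 1))).symm
  have h := intervalIntegral.integral_mono_on (a := t) (b := t + 1) (by linarith)
    intervalIntegrable_const (intervalIntegrable_one_sub_survival Q F i t (t + 1))
    fun s hs => sub_le_sub_left (hQ.survival_antitoneOn F i ht (ht.trans hs.1) hs.1) 1
  simp only [intervalIntegral.integral_const, add_sub_cancel_left, one_smul] at h
  linarith [hQ.deadTime_nonneg F ht i]

/-- The backward equation for survival, integrated over `[0, T]`; conservativity removes the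
constant `T`. Sites of `R i` outside `F` cause no trouble, because survival vanishes there. -/
theorem sum_mul_deadTime (hQ : IsRowFiniteConservative Q R) {F : Finset S} (T : ℝ)
    {i : S} (hi : i ∈ F) : ∑ j ∈ R i, Q i j * deadTime Q F T j = 1 - survival Q F T i := by
  have hint : ∑ k ∈ F, Q i k * ∫ t in (0 : ℝ)..T, survival Q F t k = survival Q F T i - 1 := by
    have hcont : ∀ k, Continuous fun t => Q i k * survival Q F t k := fun k =>
      continuous_const.mul (continuous_survival Q F k)
    have h := intervalIntegral.integral_eq_sub_of_hasDerivAt (a := 0) (b := T)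
      (fun t _ => hasDerivAt_survival Q t hi)
      ((continuous_finsetSum _ fun k _ => hcont k).intervalIntegrable 0 T)
    rw [survival_zero Q hi, intervalIntegral.integral_finsetSum
      fun k _ => (hcont k).intervalIntegrable 0 T] at h
    simpa only [intervalIntegral.integral_const_mul] using h
  have hF : ∑ k ∈ F, Q i k * (∫ t in (0 : ℝ)..T, survival Q F t k)
      = ∑ k ∈ R i, Q i k * ∫ t in (0 : ℝ)..T, survival Q F t k := by
    rw [hQ.sum_eq_of_subset i (Finset.subset_union_right (s₁ := F))]
    refine Finset.sum_subset Finset.subset_union_left fun k _ hk => ?_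
    simp [survival_notMem Q _ hk]
  simp only [deadTime_eq, mul_sub, Finset.sum_sub_distrib, ← Finset.sum_mul,
    hQ.row_sum_eq_zero, ← hF, hint]
  ring

theorem tendsto_deadTime_zero (hQ : IsRowFiniteConservative Q R) (hreg : IsNonexplosive Q R) {T : ℝ}
    (hT : 0 < T) (i : S) : Tendsto (fun F => deadTime Q F T i) atTop (𝓝 0) := by
  have hbdd : ∀ i, BddBelow (Set.range fun F => deadTime Q F T i) := fun i =>
    ⟨0, by rintro _ ⟨F, rfl⟩; exact hQ.deadTime_nonneg F hT.le i⟩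
  have hlim : ∀ i, Tendsto (fun F => deadTime Q F T i) atTop (𝓝 (⨅ F, deadTime Q F T i)) :=
    fun i => tendsto_atTop_ciInf (hQ.deadTime_antitone hT.le i) (hbdd i)
  have hzero : (fun i => ⨅ F, deadTime Q F T i) = 0 := by
    refine hreg T⁻¹ T _ (inv_pos.2 hT) (fun i => le_ciInf fun F => hQ.deadTime_nonneg F hT.le i)
      (fun i => ?_) fun i => ?_
    -- For `F = ∅` the chain is dead throughout, so the dead time is exactly `T`.
    · refine (ciInf_le (hbdd i) ∅).trans ?_
      simp [deadTime_eq, survival]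
    · refine le_of_tendsto_of_tendsto ((hlim i).const_mul T⁻¹)
        (tendsto_finsetSum _ fun j _ => (hlim j).const_mul (Q i j)) ?_
      filter_upwards [eventually_ge_atTop {i}] with F hF
      rw [hQ.sum_mul_deadTime T (Finset.singleton_subset_iff.1 hF), inv_mul_le_iff₀ hT]
      exact hQ.deadTime_le_mul F hT.le i
  have h := hlim i
  rwa [congrFun hzero i] at h

/-- The minimal semigroup of a regular `Q`-matrix is honest. -/
theorem isTransitionMatrix_minimalSemigroup (hQ : IsRowFiniteConservative Q R)
    (hreg : IsNonexplosive Q R) : IsTransitionMatrix (minimalSemigroup Q) where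
  toIsSubTransitionMatrix := hQ.isSubTransitionMatrix_minimalSemigroup
  row_eq_one t i := by
    have hp := hQ.isSubTransitionMatrix_minimalSemigroup
    refine le_antisymm (hp.row_le_one t i) ?_
    have h := hQ.tendsto_deadTime_zero hreg (add_pos_of_nonneg_of_pos t.2 one_pos) i
    have h1 : ∀ F, 1 - deadTime Q F (t + 1) i ≤ ∑' j, minimalSemigroup Q t i j := fun F => by
      have h2 := hQ.one_sub_survival_le_deadTime F t.2 i
      have h3 : survival Q F t i ≤ ∑ j ∈ F, minimalSemigroup Q t i j :=
        Finset.sum_le_sum fun j _ => hQ.killedSemigroup_le_minimalSemigroup F t i j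
      have h4 := (hp.summable_row t i).sum_le_tsum F fun j _ => hp.nonneg t i j
      simp only [NNReal.val_eq_coe] at h2
      linarith
    simpa using le_of_tendsto' (h.const_sub 1) h1

end IsRowFiniteConservative

end MinimalSemigroup

/-! ### Integer paths with one-sided step bounds -/

section IntegerPaths

variable {x : ℕ → ℤ}

/-- A sequence of integers with steps at most `1` takes every intermediate value on its way up. -/
theorem exists_eq_of_le_of_step_le_one (hx : ∀ k, x (k + 1) ≤ x k + 1) {n : ℤ} (h0 : x 0 ≤ n)
    (hn : ∃ k, n ≤ x k) : ∃ k, x k = n := by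
  classical
  have hspec := Nat.find_spec hn
  refine ⟨Nat.find hn, ?_⟩
  rcases hk : Nat.find hn with _ | k
  · rw [hk] at hspec; omega
  · have := Nat.find_min hn (m := k) (by omega)
    have := hx k
    rw [hk] at hspec
    omega

/-- A sequence of integers with steps at least `-L` meets every interval of length `L` on its way
down. -/
theorem exists_mem_Ico_of_sub_le_step {L : ℤ} (hx : ∀ k, x k - L ≤ x (k + 1)) {n : ℤ}
    (h0 : n ≤ x 0) (hn : ∃ k, x k < n) : ∃ k, x k ∈ Set.Ico (n - L) n := by
  classical
  have hspec := Nat.find_spec hn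
  refine ⟨Nat.find hn, ?_, hspec⟩
  rcases hk : Nat.find hn with _ | k
  · rw [hk] at hspec; omega
  · have := Nat.find_min hn (m := k) (by omega)
    have := hx k
    omega

theorem unbounded_of_injective (hx : Function.Injective x) :
    (∀ n, ∃ k, n ≤ x k) ∨ ∀ n, ∃ k, x k < n := by
  by_contra! h
  obtain ⟨⟨a, ha⟩, b, hb⟩ := h
  refine Set.infinite_range_of_injective hx ((Set.finite_Icc b a).subset ?_)
  rintro _ ⟨k, rfl⟩
  exact ⟨hb k, (ha k).le⟩

end IntegerPaths

/-! ### The random environment -/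

namespace Env

variable {L : ℕ}

theorem qMatrix_eq_add (ω : Env L) (i j : ℤ) : ω.qMatrix i j =
    (if j = i + 1 then (ω.birth i : ℝ) else 0) + (if j = i then -(ω.totalRate i : ℝ) else 0)
      + ∑ l : Fin L, if j = i - ((l : ℤ) + 1) then (ω.death i l : ℝ) else 0 := by
  unfold qMatrix
  split_ifs with h1 h2 h2
  · omega
  · rw [Finset.sum_eq_zero fun l _ => if_neg (by omega)]; ring
  · rw [Finset.sum_eq_zero fun l _ => if_neg (by omega)]; ring
  · ring

theorem qMatrix_self (ω : Env L) (i : ℤ) : ω.qMatrix i i = -(ω.totalRate i : ℝ) := by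
  simp [qMatrix]

theorem isRowFiniteConservative_qMatrix (ω : Env L) :
    IsRowFiniteConservative ω.qMatrix fun i => Finset.Icc (i - L) (i + 1) where
  offDiag_nonneg i j hij := by
    rw [qMatrix_eq_add, if_neg hij.symm, add_zero]
    refine add_nonneg (by split_ifs <;> positivity)
      (Finset.sum_nonneg fun l _ => by split_ifs <;> positivity)
  apply_eq_zero i j hj := by
    rw [Finset.mem_Icc] at hj
    rw [qMatrix_eq_add, if_neg (by omega), if_neg (by omega),
      Finset.sum_eq_zero fun l _ => if_neg (by omega), add_zero, add_zero]
  row_sum_eq_zero i := by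
    simp only [qMatrix_eq_add, Finset.sum_add_distrib]
    rw [Finset.sum_comm]
    simp only [Finset.sum_ite_eq', Finset.mem_Icc]
    rw [if_pos (by omega), if_pos (by omega),
      Finset.sum_congr rfl fun l _ => if_pos (by omega), totalRate]
    push_cast
    ring

/-- Isolating the diagonal term gives `(c + q_i) w_i ≤ ∑_{j ≠ i} q_ij w_j`, at most `q_i` times the
maximum of `w` over the other sites in the window. The maximizer may have `q_ij = 0`: only its
position and the growth of `w` matter. -/
theorem exists_neighbor_ge (ω : Env L) {c : ℝ} {w : ℤ → ℝ} {i : ℤ}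
    (hrate : 0 < ω.totalRate i)
    (hw : c * w i ≤ ∑ j ∈ Finset.Icc (i - L) (i + 1), ω.qMatrix i j * w j) :
    ∃ j ∈ Finset.Icc (i - L : ℤ) (i + 1), w i + c * w i * (ω.totalRate i : ℝ)⁻¹ ≤ w j := by
  have hQ := ω.isRowFiniteConservative_qMatrix
  have hmem : i ∈ Finset.Icc (i - L : ℤ) (i + 1) := by rw [Finset.mem_Icc]; omega
  obtain ⟨j, hj, hmax⟩ := Finset.exists_max_image ((Finset.Icc (i - L : ℤ) (i + 1)).erase i) w
    ⟨i + 1, by simp; omega⟩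
  refine ⟨j, Finset.mem_of_mem_erase hj, ?_⟩
  have hq : (0 : ℝ) < ω.totalRate i := hrate
  have hsum := hQ.row_sum_eq_zero i
  rw [← Finset.add_sum_erase _ _ hmem, qMatrix_self] at hsum hw
  have hle : ∑ k ∈ (Finset.Icc (i - L : ℤ) (i + 1)).erase i, ω.qMatrix i k * w k
      ≤ ω.totalRate i * w j := by
    rw [show (ω.totalRate i : ℝ)
      = ∑ k ∈ (Finset.Icc (i - L : ℤ) (i + 1)).erase i, ω.qMatrix i k by linarith, Finset.sum_mul]
    exact Finset.sum_le_sum fun k hk => mul_le_mul_of_nonneg_left (hmax k hk)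
      (hQ.offDiag_nonneg i k (Finset.ne_of_mem_erase hk).symm)
  rw [← div_eq_mul_inv, ← le_sub_iff_add_le', div_le_iff₀ hq]
  linarith

/-- A nonzero bounded solution of `c w ≤ Q w` grows along a path of distinct states with summable
mean holding times. -/
theorem exists_path_of_ne_zero (ω : Env L) (hrate : ∀ i, 0 < ω.totalRate i) {c B : ℝ} {w : ℤ → ℝ}
    (hc : 0 < c) (h0 : ∀ i, 0 ≤ w i) (hB : ∀ i, w i ≤ B)
    (hw : ∀ i, c * w i ≤ ∑ j ∈ Finset.Icc (i - L : ℤ) (i + 1), ω.qMatrix i j * w j)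
    (hne : w ≠ 0) :
    ∃ x : ℕ → ℤ, Function.Injective x ∧ (∀ k, x (k + 1) ≤ x k + 1) ∧
      (∀ k, x k - L ≤ x (k + 1)) ∧ Summable fun k => (ω.totalRate (x k))⁻¹ := by
  obtain ⟨i₀, hi₀⟩ := Function.ne_iff.1 hne
  have hi₀ : 0 < w i₀ := lt_of_le_of_ne (h0 i₀) (Ne.symm hi₀)
  have hstep : ∀ i : {i // 0 < w i}, ∃ j : {i // 0 < w i},
      j.1 ∈ Finset.Icc (i.1 - L : ℤ) (i + 1) ∧
        w i + c * w i * (ω.totalRate i : ℝ)⁻¹ ≤ w j := fun ⟨i, hi⟩ => by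
    obtain ⟨j, hj, hij⟩ := ω.exists_neighbor_ge (hrate i) (hw i)
    refine ⟨⟨j, lt_of_lt_of_le hi (le_trans ?_ hij)⟩, hj, hij⟩
    have : 0 ≤ c * w i * (ω.totalRate i : ℝ)⁻¹ := by positivity
    linarith
  choose g hg hgw using hstep
  set y : ℕ → {i // 0 < w i} := fun k => g^[k] ⟨i₀, hi₀⟩
  have hsucc : ∀ k, y (k + 1) = g (y k) := fun k => Function.iterate_succ_apply' g k _
  have hpos : ∀ k, 0 < (ω.totalRate (y k) : ℝ)⁻¹ := fun k => inv_pos.2 (hrate _)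
  have hmono : StrictMono fun k => w (y k) := strictMono_nat_of_lt_succ fun k => by
    have h := hgw (y k)
    have : 0 < c * w (y k) * (ω.totalRate (y k) : ℝ)⁻¹ :=
      mul_pos (mul_pos hc (y k).2) (hpos k)
    rw [hsucc]
    linarith
  -- Since `w` increases along the path, each increment is at least the constant `c * w i₀` times
  -- the mean holding time; the bound `B` then yields summability.
  have hsum : ∀ n, ∑ k ∈ Finset.range n, c * w i₀ * (ω.totalRate (y k) : ℝ)⁻¹ ≤ w (y n) := by
    intro n
    induction n with
    | zero => simpa using h0 _
    | succ n ih =>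
      have h := hgw (y n)
      rw [← hsucc] at h
      have h1 : w i₀ ≤ w (y n) := hmono.monotone (Nat.zero_le n)
      have h2 : c * w i₀ * (ω.totalRate (y n) : ℝ)⁻¹ ≤ c * w (y n) * (ω.totalRate (y n) : ℝ)⁻¹ :=
        mul_le_mul_of_nonneg_right (mul_le_mul_of_nonneg_left h1 hc.le) (hpos n).le
      rw [Finset.sum_range_succ]
      linarith
  refine ⟨fun k => y k, fun k l hkl => hmono.injective (congrArg w hkl), fun k => ?_, fun k => ?_,
    ?_⟩
  · simpa only [hsucc] using (Finset.mem_Icc.1 (hg (y k))).2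
  · simpa only [hsucc] using (Finset.mem_Icc.1 (hg (y k))).1
  · have h := summable_of_sum_range_le (fun k => (mul_pos (mul_pos hc hi₀) (hpos k)).le)
      fun n => (hsum n).trans (hB _)
    rw [summable_mul_left_iff (mul_pos hc hi₀).ne'] at h
    rw [← NNReal.summable_coe]
    simpa only [NNReal.coe_inv] using h

/-- Positivity reconciles the conventions `1 / 0 = ∞` of (C2) and `0⁻¹ = 0` in `ℝ≥0`. -/
theorem not_summable_inv_of_tsum_inv_eq_top {f : ℕ → ℝ≥0} (hf : ∀ m, 0 < f m)
    (h : ∑' m, (f m : ℝ≥0∞)⁻¹ = ∞) : ¬ Summable fun m => (f m)⁻¹ := by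
  rw [← ENNReal.tsum_coe_ne_top_iff_summable, not_not, ← h]
  exact tsum_congr fun m => ENNReal.coe_inv (hf m).ne'

theorem not_forall_exists_le_of_summable (ω : Env L) (hrate : ∀ i, 0 < ω.totalRate i)
    (hdiv : ∑' m : ℕ, ((ω.totalRate ((m : ℤ) + 1) : ℝ≥0∞))⁻¹ = ∞) {x : ℕ → ℤ}
    (hup : ∀ k, x (k + 1) ≤ x k + 1) (hx : Summable fun k => (ω.totalRate (x k))⁻¹) :
    ¬ ∀ n, ∃ k, n ≤ x k := by
  intro h
  refine not_summable_inv_of_tsum_inv_eq_top (fun m => hrate _) hdiv ?_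
  set N := (x 0).toNat
  -- The shift by `N` puts every target above the start `x 0`; dropping `N` terms does not affect
  -- divergence.
  have hex : ∀ m : ℕ, ∃ k, x k = ((m + N : ℕ) : ℤ) + 1 := fun m =>
    exists_eq_of_le_of_step_le_one hup (by omega) (h _)
  choose k hk using hex
  have hinj : Function.Injective k := fun a b hab => by
    have := hk a
    rw [hab, hk b] at this
    omega
  rw [← NNReal.summable_coe, ← summable_nat_add_iff N]
  have hcomp := (NNReal.summable_coe.2 hx).comp_injective hinj
  simpa only [Function.comp_def, hk] using hcomp

theorem totalRate_le_blockMaxRate (ω : Env L) {n i : ℤ} (hi : i ∈ Set.Ico (n * L - L) (n * L)) :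
    ω.totalRate i ≤ ω.blockMaxRate n := by
  obtain ⟨h1, h2⟩ := hi
  have hlt : (n * L - 1 - i).toNat < L := by omega
  have h := Finset.le_sup (f := fun k : Fin L => ω.totalRate (n * (L : ℤ) - ((k : ℤ) + 1)))
    (Finset.mem_univ ⟨_, hlt⟩)
  have hidx : n * (L : ℤ) - (((n * L - 1 - i).toNat : ℤ) + 1) = i := by omega
  rw [hidx] at h
  exact h

/-- Choose one visited site in each block far enough down. Its rate is at most the block maximum and
distinct blocks give distinct times, so the series of reciprocal block maxima would converge. -/
theorem not_forall_exists_lt_of_summable (hL : 1 ≤ L) (ω : Env L)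
    (hrate : ∀ i, 0 < ω.totalRate i)
    (hdiv : ∑' m : ℕ, ((ω.blockMaxRate (-(m : ℤ)) : ℝ≥0∞))⁻¹ = ∞) {x : ℕ → ℤ}
    (hdown : ∀ k, x k - L ≤ x (k + 1)) (hx : Summable fun k => (ω.totalRate (x k))⁻¹) :
    ¬ ∀ n, ∃ k, x k < n := by
  intro h
  have hpos : ∀ n : ℤ, 0 < ω.blockMaxRate n := fun n =>
    (hrate (n * L - L)).trans_le (ω.totalRate_le_blockMaxRate ⟨le_rfl, by omega⟩)
  refine not_summable_inv_of_tsum_inv_eq_top (fun m => hpos _) hdiv ?_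
  set N := (-x 0).toNat
  have hL' : (1 : ℤ) ≤ L := by exact_mod_cast hL
  have hstart : ∀ m : ℕ, -((m + N : ℕ) : ℤ) * L ≤ x 0 := fun m => by
    have h1 : -x 0 ≤ (m + N : ℕ) := by omega
    have h2 := le_mul_of_one_le_right (Int.natCast_nonneg (m + N)) hL'
    linarith
  have hex : ∀ m : ℕ, ∃ k, x k ∈ Set.Ico (-((m + N : ℕ) : ℤ) * L - L) (-((m + N : ℕ) : ℤ) * L) :=
    fun m => exists_mem_Ico_of_sub_le_step hdown (hstart m) (h _)
  choose k hk using hex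
  have hinj : Function.Injective k := fun a b hab => by
    obtain ⟨h1, h2⟩ := hk a
    obtain ⟨h3, h4⟩ := hk b
    rw [hab] at h1 h2
    push_cast at h1 h2 h3 h4
    have hab : (a : ℤ) < b + 1 := by
      by_contra! hlt
      have := mul_le_mul_of_nonneg_right hlt (zero_le_one.trans hL')
      linarith
    have hba : (b : ℤ) < a + 1 := by
      by_contra! hlt
      have := mul_le_mul_of_nonneg_right hlt (zero_le_one.trans hL')
      linarith
    omega
  rw [← NNReal.summable_coe, ← summable_nat_add_iff N]
  have hcomp := (NNReal.summable_coe.2 hx).comp_injective hinj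
  refine Summable.of_nonneg_of_le (fun m => NNReal.coe_nonneg _) (fun m => ?_) hcomp
  exact NNReal.coe_le_coe.2 (inv_anti₀ (hrate _) (ω.totalRate_le_blockMaxRate (hk m)))

theorem isNonexplosive_qMatrix (hL : 1 ≤ L) (ω : Env L) (hrate : ∀ i, 0 < ω.totalRate i)
    (hup : ∑' m : ℕ, ((ω.totalRate ((m : ℤ) + 1) : ℝ≥0∞))⁻¹ = ∞)
    (hdown : ∑' m : ℕ, ((ω.blockMaxRate (-(m : ℤ)) : ℝ≥0∞))⁻¹ = ∞) :
    IsNonexplosive ω.qMatrix fun i => Finset.Icc (i - L) (i + 1) := by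
  intro c B w hc h0 hB hw
  by_contra hne
  obtain ⟨x, hinj, hx1, hx2, hsum⟩ := ω.exists_path_of_ne_zero hrate hc h0 hB hw hne
  rcases unbounded_of_injective hinj with h | h
  · exact ω.not_forall_exists_le_of_summable hrate hup hx1 hsum h
  · exact not_forall_exists_lt_of_summable hL ω hrate hdown hx2 hsum h

/-- Identical distribution carries (C1) from the site 0 to each of the countably many sites. -/
theorem ae_forall_totalRate_pos {P : Measure (Env L)} (hiid : IsIIDEnv P) (hC1 : CondC1 P) :
    ∀ᵐ ω ∂P, ∀ i, 0 < ω.totalRate i := by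
  refine ae_all_iff.2 fun i => ?_
  have hmeas : MeasurableSet {v : (Fin L → ℝ≥0) × ℝ≥0 | 0 < v.2 + ∑ l, v.1 l} := by
    refine measurableSet_lt measurable_const ?_
    fun_prop
  exact (hiid.2 i).symm.ae_snd hmeas hC1

end Env

theorem proposition1 (L : ℕ) (hL : 1 ≤ L) (P : Measure (Env L)) [IsProbabilityMeasure P]
    (hiid : IsIIDEnv P) (hC1 : CondC1 P) (hC2 : CondC2 P) :
    ∀ᵐ ω ∂P, ∃ p : ℝ≥0 → Matrix ℤ ℤ ℝ,
      IsTransitionMatrix p ∧ HasQMatrix p ω.qMatrix ∧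
        ∀ p' : ℝ≥0 → Matrix ℤ ℤ ℝ,
          IsSubTransitionMatrix p' → HasQMatrix p' ω.qMatrix → p' = p := by
  filter_upwards [Env.ae_forall_totalRate_pos hiid hC1, hC2] with ω hrate hdiv
  have hQ := ω.isRowFiniteConservative_qMatrix
  have hp := hQ.isTransitionMatrix_minimalSemigroup
    (Env.isNonexplosive_qMatrix hL ω hrate hdiv.1 hdiv.2)
  exact ⟨minimalSemigroup ω.qMatrix, hp, hQ.hasQMatrix_minimalSemigroup,
    fun _ hp' hpQ' => eq_minimalSemigroup_of_isTransitionMatrix hp hp' hpQ'⟩
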